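/- Let $T=\mathrm{co}(V)\subset\mathbb{R}^3$ be a (nondegenerate) tetrahedron with vertex set $V=\{v_1,v_2,v_3,v_4\}$ and circumradius $r(V)$. A pair $(R^L,O^L)$, with $R^L>0$ and $O^L\in\mathbb{R}^3$, is called a four-crossing radius and a four-crossing point of $T$ if there are four distinct spheres $S_1,\dots,S_4$ of radius $R^L$ such that $v_i\in S_j$ whenever $i\ne j$, $S_1\cap S_2\cap S_3\cap S_4=\{O^L\}$, and $O^L$ does not lie on the circumsphere of $T$. For $\rho>0$ let $\mathrm{co}_\rho(V)$, the $\rho$-hulloid of $V$, be the intersection of the complements of all open balls of radius $\rho$ that do not meet $V$, and let $$r_L(V)=\inf\{\rho>r(V):\ \mathrm{int}(\mathrm{co}_\rho(V))\neq\emptyset\}.$$ Let $(R^L,O^L)$ be a four-crossing radius and a four-crossing point of $T$ with $O^L\in\mathrm{int}(T)$. Then $R^L$ and $O^L$ are uniquely determined: every four-crossing radius and point $(R',O')$ of $T$ with $O'\in\mathrm{int}(T)$ satisfies $R'=R^L$ and $O'=O^L$. More precisely, $R^L=r_L(V)>r(V)$, and $O^L=O^*$, where $O^*$ is the unique point outside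 $V$ with $\mathrm{co}_{r_L(V)}(V)=V\cup\{O^*\}$. -/

import Mathlib

/-- Euclidean three-dimensional space. -/
abbrev E3 : Type := EuclideanSpace ℝ (Fin 3)

/-- A tetrahedron in space: four affinely independent vertices `T.points 0, …, T.points 3`. -/
abbrev Tetrahedron : Type := Affine.Simplex ℝ E3 3

/-- The vertex set `V` of a tetrahedron. -/
def Tetrahedron.vertices (T : Tetrahedron) : Set E3 := Set.range T.points

/-- The tetrahedron as a solid body, `co(V)`. -/
def Tetrahedron.solid (T : Tetrahedron) : Set E3 := convexHull ℝ T.vertices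

/-- The `ρ`-hulloid of `E`: the intersection of the complements of all open balls of
radius `ρ` that do not meet `E` (the whole space if there is no such ball). -/
def hulloid (ρ : ℝ) (E : Set E3) : Set E3 :=
  ⋂ (z : E3) (_ : Metric.ball z ρ ∩ E = ∅), (Metric.ball z ρ)ᶜ

/-- The critical radius `r_L(V)`: the infimum of the `ρ > r(V)`, with `r(V)` the circumradius,
for which the `ρ`-hulloid of the vertex set is full, that is, has nonempty interior. -/
noncomputable def Tetrahedron.rL (T : Tetrahedron) : ℝ :=
  sInf {ρ : ℝ | T.circumradius < ρ ∧ (interior (hulloid ρ T.vertices)).Nonempty}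

/-- `R` is a four-crossing radius of `T` and `O` a corresponding four-crossing point. -/
def Tetrahedron.IsFourCrossing (T : Tetrahedron) (R : ℝ) (O : E3) : Prop :=
  0 < R ∧
  ∃ S : Fin 4 → EuclideanGeometry.Sphere E3,
    Function.Injective S ∧
    (∀ j, (S j).radius = R) ∧
    (∀ j i, i ≠ j → T.points i ∈ S j) ∧
    (⋂ j, {x : E3 | x ∈ S j}) = {O} ∧
    O ∉ T.circumsphere

/-!
Take the crossing point as the origin and let `c j` be the centre of the `j`-th crossing sphere.
The barycentric coordinates of a point `z` with respect to the `c j` are positive multiples of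
`‖v j - z‖ ^ 2 - ‖z‖ ^ 2`, where `v j` is the `j`-th vertex. If a ball of radius `ρ ≥ R` about `z`
has no vertex in its interior while its closure contains the origin, then all these coordinates
`ν j` are at least a multiple of `ρ ^ 2 - ‖z‖ ^ 2`. Inserting this, and lower bounds for
`‖c j - c k‖`, into `2 ‖z‖ ^ 2 = 2 R ^ 2 - ∑ ν j ν k ‖c j - c k‖ ^ 2` gives, for `N` vertices,
`(N - 1) ^ 2 (ρ ^ 2 - ‖z‖ ^ 2) ≤ 8 (R ^ 2 - ‖z‖ ^ 2)`. As `(N - 1) ^ 2 > 8` for `N ≥ 4`, this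
forces `‖z‖ = ρ = R`. So balls of radius `R` missing the vertices also miss the crossing point,
balls of larger radius stay away from a neighbourhood of it, and the balls bounded by the crossing
spheres cover the rest of the simplex except the vertices.
-/

open scoped InnerProductSpace

section BallHull

/-- The `ρ`-hulloid of a subset of a metric space: the intersection of the complements of all open
balls of radius `ρ` that miss the set. In `E3` it unfolds to `hulloid`. -/
def ballHull {X : Type*} [PseudoMetricSpace X] (ρ : ℝ) (A : Set X) : Set X :=
  ⋂ (z : X) (_ : Metric.ball z ρ ∩ A = ∅), (Metric.ball z ρ)ᶜ

section Metric

variable {X : Type*} [PseudoMetricSpace X] {ρ : ℝ} {A : Set X} {x : X}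

lemma mem_ballHull_iff : x ∈ ballHull ρ A ↔ ∀ z, (∀ a ∈ A, ρ ≤ dist a z) → ρ ≤ dist x z := by
  simp only [ballHull, Set.mem_iInter, Set.mem_compl_iff, Metric.mem_ball, not_lt,
    Set.eq_empty_iff_forall_notMem, Set.mem_inter_iff, not_and']

lemma subset_ballHull (ρ : ℝ) (A : Set X) : A ⊆ ballHull ρ A := fun a ha =>
  mem_ballHull_iff.2 fun _ hz => hz a ha

lemma mem_interior_ballHull [ProperSpace X]
    (h : ∀ z, (∀ a ∈ A, ρ ≤ dist a z) → ρ < dist x z) : x ∈ interior (ballHull ρ A) := by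
  set Z : Set X := {z | ∀ a ∈ A, ρ ≤ dist a z} with hZ
  have hZ_closed : IsClosed Z := by
    simp only [hZ, Set.ofPred_forall]
    exact isClosed_biInter fun a _ => isClosed_le continuous_const (by fun_prop)
  obtain ⟨ε, hε, hgap⟩ : ∃ ε > 0, ∀ z ∈ Z, ρ + ε ≤ dist x z := by
    rcases Z.eq_empty_or_nonempty with hZ_empty | hZ_nonempty
    · exact ⟨1, one_pos, fun z hz => by simp [hZ_empty] at hz⟩
    · obtain ⟨z₀, hz₀, hmin⟩ := hZ_closed.exists_infDist_eq_dist hZ_nonempty x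
      refine ⟨dist x z₀ - ρ, sub_pos.2 (h z₀ hz₀), fun z hz => ?_⟩
      rw [add_sub_cancel, ← hmin]
      exact Metric.infDist_le_dist_of_mem hz
  refine mem_interior.2 ⟨Metric.ball x ε, fun y hy => mem_ballHull_iff.2 fun z hz => ?_,
    Metric.isOpen_ball, Metric.mem_ball_self hε⟩
  have := hgap z hz
  have := dist_triangle x y z
  rw [Metric.mem_ball'] at hy
  linarith

end Metric

lemma ballHull_mono_radius {E : Type*} [SeminormedAddCommGroup E] [NormedSpace ℝ E] {ρ R : ℝ}
    (hρ : 0 < ρ) (hρR : ρ ≤ R) (A : Set E) : ballHull ρ A ⊆ ballHull R A := by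
  intro x hx
  rw [mem_ballHull_iff] at hx ⊢
  intro z hz
  by_contra! hlt
  obtain ⟨y, hxy, hyz⟩ : ∃ y, dist x y < ρ ∧ dist y z ≤ R - ρ :=
    exists_dist_lt_le hρ (sub_nonneg.2 hρR) (by rwa [sub_add_cancel])
  refine hxy.not_ge (hx y fun a ha => ?_)
  linarith [hz a ha, dist_triangle a y z]

/-- A ball of radius `ρ` around a point of the normal ray of `K` through `x` contains `x` and
misses `K`. -/
lemma ballHull_subset_of_convex {E : Type*} [NormedAddCommGroup E] [InnerProductSpace ℝ E] {ρ : ℝ}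
    (hρ : 0 < ρ) {A K : Set E} (hAK : A ⊆ K) (hK : Convex ℝ K) (hK_complete : IsComplete K)
    (hK_nonempty : K.Nonempty) : ballHull ρ A ⊆ K := by
  intro x hx
  by_contra hxK
  obtain ⟨p, hpK, hp⟩ := exists_norm_eq_iInf_of_complete_convex hK_nonempty hK_complete hK x
  have hnormal := (norm_eq_iInf_iff_real_inner_le_zero hK hpK).1 hp
  have hd : 0 < ‖x - p‖ := norm_pos_iff.2 (sub_ne_zero.2 fun h => hxK (h ▸ hpK))
  set d := ‖x - p‖
  set t := max ρ d with ht
  have ht0 : 0 < t := hρ.trans_le (le_max_left _ _)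
  have hmiss : ∀ a ∈ A, ρ ≤ dist a (p + (t / d) • (x - p)) := fun a ha => by
    have h1 : t * d ≤ ⟪x - p, p + (t / d) • (x - p) - a⟫_ℝ := by
      have h2 : p + (t / d) • (x - p) - a = (t / d) • (x - p) - (a - p) := by abel
      have h3 : t / d * d ^ 2 = t * d := by field_simp
      rw [h2, inner_sub_right, real_inner_smul_right, real_inner_self_eq_norm_sq, h3]
      linarith [hnormal a (hAK ha)]
    have h4 := h1.trans (real_inner_le_norm _ _)
    rw [mul_comm, mul_le_mul_iff_right₀ hd] at h4
    rw [dist_comm, dist_eq_norm]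
    exact (le_max_left _ _).trans h4
  have hdist : dist x (p + (t / d) • (x - p)) = t - d := by
    have h1 : p + (t / d) • (x - p) - x = (t / d - 1) • (x - p) := by
      rw [sub_smul, one_smul]; abel
    have h2 : 0 ≤ t / d - 1 := sub_nonneg.2 ((one_le_div hd).2 (le_max_right _ _))
    rw [dist_comm, dist_eq_norm, h1, norm_smul, Real.norm_of_nonneg h2, sub_mul, one_mul,
      div_mul_cancel₀ _ hd.ne']
  have hlt : t - d < ρ := by
    rw [sub_lt_iff_lt_add, ht]
    exact max_lt (by linarith) (by linarith)
  exact (hdist ▸ mem_ballHull_iff.1 hx _ hmiss).not_gt hlt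

end BallHull

section ConvexHull

lemma dist_lt_of_mem_convexHull {E : Type*} [NormedAddCommGroup E] [NormedSpace ℝ E]
    [StrictConvexSpace ℝ E] {A : Set E} {x z : E} {R : ℝ} (hR : R ≠ 0)
    (hA : ∀ a ∈ A, dist a z ≤ R) (hx : x ∈ convexHull ℝ A) (hxA : x ∉ A) : dist x z < R := by
  have hsub : convexHull ℝ A ⊆ Metric.closedBall z R := convexHull_min hA (convex_closedBall z R)
  refine lt_of_le_of_ne (hsub hx) fun heq => hxA (extremePoints_convexHull_subset (𝕜 := ℝ) ?_)
  exact inter_extremePoints_subset_extremePoints_of_subset hsub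
    ⟨hx, StrictConvexSpace.sphere_subset_extremePoints_closedBall _ hR heq⟩

variable {𝕜 E ι : Type*} [Field 𝕜] [LinearOrder 𝕜] [IsStrictOrderedRing 𝕜] [AddCommGroup E]
  [Module 𝕜 E]

lemma mem_convexHull_range_iff [Fintype ι] {v : ι → E} {x : E} :
    x ∈ convexHull 𝕜 (Set.range v) ↔ ∃ w ∈ stdSimplex 𝕜 ι, ∑ i, w i • v i = x := by
  classical
  have h : Set.range v = Fintype.linearCombination 𝕜 v '' Set.range fun i => Pi.single i 1 := by
    rw [← Set.range_comp]
    congr 1 with i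
    simp [Fintype.linearCombination_apply_single]
  rw [h, ← LinearMap.image_convexHull, convexHull_rangle_single_eq_stdSimplex]
  rfl

lemma exists_mul_le_of_sum_eq_one [Fintype ι] {a w : ι → 𝕜} (ha : ∀ i, 0 ≤ a i)
    (hw : ∀ i, 0 ≤ w i) (hw1 : ∑ i, w i = 1) :
    ∃ t, 0 ≤ t ∧ (∀ i, t * w i ≤ a i) ∧ ∃ j, t * w j = a j := by
  obtain ⟨k, -, hk⟩ : ∃ k ∈ Finset.univ, 0 < w k := Finset.exists_lt_of_sum_lt (by simp [hw1])
  obtain ⟨j, hj, hmin⟩ := ({i | 0 < w i} : Finset ι).exists_min_image (fun i => a i / w i)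
    ⟨k, by simpa using hk⟩
  replace hj : 0 < w j := by simpa using hj
  refine ⟨a j / w j, div_nonneg (ha j) hj.le, fun i => ?_, j, div_mul_cancel₀ _ hj.ne'⟩
  rcases (hw i).eq_or_lt with hi | hi
  · simpa [← hi] using ha i
  · exact (le_div_iff₀ hi).1 (hmin i (by simpa using hi))

/-- Moving from `x` away from `O`, one leaves the hull through a face missing some vertex `j`. -/
lemma exists_mem_convexHull_range_update [Finite ι] [DecidableEq ι] {v : ι → E} {O x : E}
    (hO : O ∈ convexHull 𝕜 (Set.range v)) (hx : x ∈ convexHull 𝕜 (Set.range v)) :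
    ∃ j, x ∈ convexHull 𝕜 (Set.range (Function.update v j O)) := by
  have := Fintype.ofFinite ι
  obtain ⟨w, ⟨hw0, hw1⟩, rfl⟩ := mem_convexHull_range_iff.1 hO
  obtain ⟨a, ⟨ha0, ha1⟩, rfl⟩ := mem_convexHull_range_iff.1 hx
  obtain ⟨t, ht0, ht, j, hj⟩ := exists_mul_le_of_sum_eq_one ha0 hw0 hw1
  have hweight : ∀ i, Function.update (fun i => a i - t * w i) j t i
      = a i - t * w i + if i = j then t else 0 := fun i => by
    rcases eq_or_ne i j with rfl | hij
    · simp [hj]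
    · simp [hij]
  have hpoint : ∀ i, Function.update (fun i => a i - t * w i) j t i •
      Function.update v j (∑ k, w k • v k) i
      = a i • v i - t • (w i • v i) + if i = j then t • ∑ k, w k • v k else 0 := fun i => by
    rw [← mul_smul, ← sub_smul]
    rcases eq_or_ne i j with rfl | hij
    · simp [hj]
    · simp [hij]
  refine ⟨j, mem_convexHull_range_iff.2
    ⟨Function.update (fun i => a i - t * w i) j t, ⟨fun i => ?_, ?_⟩, ?_⟩⟩
  · rw [hweight]
    have := sub_nonneg.2 (ht i)
    split_ifs <;> positivity
  · simp only [hweight, Finset.sum_add_distrib, Finset.sum_sub_distrib, ← Finset.mul_sum, ha1,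
      hw1, Fintype.sum_ite_eq']
    ring
  · simp only [hpoint, Finset.sum_add_distrib, Finset.sum_sub_distrib, ← Finset.smul_sum,
      Fintype.sum_ite_eq', sub_add_cancel]

end ConvexHull

lemma sq_card_sub_one_le_sum_div {ι : Type*} [Fintype ι] {b ν : ι → ℝ} (hb : ∀ i, 0 < b i)
    (hb1 : ∑ i, b i = 1) (hν : ν ∈ stdSimplex ℝ ι) :
    ((Fintype.card ι : ℝ) - 1) ^ 2 ≤ ∑ i, (1 - ν i) / b i := by
  have hν_le : ∀ i, ν i ≤ 1 := fun i =>
    hν.2 ▸ Finset.single_le_sum (fun j _ => hν.1 j) (Finset.mem_univ i)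
  have hsum : ∑ i, (1 - ν i) = (Fintype.card ι : ℝ) - 1 := by simp [hν.2]
  calc ((Fintype.card ι : ℝ) - 1) ^ 2 = (∑ i, (1 - ν i)) ^ 2 / ∑ i, b i := by
        rw [hsum, hb1, div_one]
    _ ≤ ∑ i, (1 - ν i) ^ 2 / b i := Finset.sq_sum_div_le_sum_sq_div _ _ fun i _ => hb i
    _ ≤ ∑ i, (1 - ν i) / b i := by
        gcongr with i
        · exact (hb i).le
        · nlinarith [hν.1 i, hν_le i]

section CrossingConfiguration

variable {E ι : Type*} [NormedAddCommGroup E] [InnerProductSpace ℝ E] [Fintype ι]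

lemma two_mul_norm_sum_smul_sq {c : ι → E} {R : ℝ} (hc : ∀ j, ‖c j‖ = R) {ν : ι → ℝ}
    (hν : ∑ j, ν j = 1) :
    2 * ‖∑ j, ν j • c j‖ ^ 2 = 2 * R ^ 2 - ∑ j, ∑ k, ν j * ν k * ‖c j - c k‖ ^ 2 := by
  have hterm : ∀ j k, ν j * ν k * ‖c j - c k‖ ^ 2
      = 2 * R ^ 2 * (ν j * ν k) - 2 * (ν j * (ν k * ⟪c k, c j⟫_ℝ)) := fun j k => by
    rw [norm_sub_sq_real, hc, hc, real_inner_comm]; ring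
  have hnorm : ‖∑ j, ν j • c j‖ ^ 2 = ∑ j, ∑ k, ν j * (ν k * ⟪c k, c j⟫_ℝ) := by
    rw [← real_inner_self_eq_norm_sq]
    simp only [inner_sum, sum_inner, real_inner_smul_left, real_inner_smul_right]
  simp only [hterm, Finset.sum_sub_distrib, ← Finset.mul_sum, hν, hnorm, mul_one]
  ring

lemma sum_mul_norm_sub_sq_sub {v : ι → E} {w : ι → ℝ} (h : ∑ i, w i • v i = 0) (z : E) :
    ∑ i, w i * (‖v i - z‖ ^ 2 - ‖z‖ ^ 2) = ∑ i, w i * ‖v i‖ ^ 2 := by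
  have hinner : ∑ i, w i * ⟪v i, z⟫_ℝ = 0 := by
    simp only [← real_inner_smul_left, ← sum_inner, h, inner_zero_left]
  have hterm : ∀ i, w i * (‖v i - z‖ ^ 2 - ‖z‖ ^ 2) = w i * ‖v i‖ ^ 2 - 2 * (w i * ⟪v i, z⟫_ℝ) :=
    fun i => by rw [norm_sub_sq_real]; ring
  simp only [hterm, Finset.sum_sub_distrib, ← Finset.mul_sum, hinner, mul_zero, sub_zero]

/-- A point, taken as the origin, is the barycentre with positive weights `w` of spanning vertices
`v`, and lies for each `j` on the sphere of radius `R` about `c j`, which passes through all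
vertices but possibly the `j`-th one. -/
structure CrossingConfiguration (v c : ι → E) (w : ι → ℝ) (R : ℝ) : Prop where
  weight_pos : ∀ i, 0 < w i
  sum_weight : ∑ i, w i = 1
  sum_weight_smul : ∑ i, w i • v i = 0
  vertex_ne_zero : ∀ i, v i ≠ 0
  span_vertices : Submodule.span ℝ (Set.range v) = ⊤
  norm_center : ∀ j, ‖c j‖ = R
  norm_vertex_sub_center : ∀ i j, i ≠ j → ‖v i - c j‖ = R

namespace CrossingConfiguration

variable {v c : ι → E} {w : ι → ℝ} {R : ℝ}

/-- The power of the `j`-th vertex with respect to the `j`-th sphere. -/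
def power (v c : ι → E) (R : ℝ) (j : ι) : ℝ := ‖v j - c j‖ ^ 2 - R ^ 2

/-- The barycentric coordinates of `z` with respect to the centres `c`. -/
noncomputable def centerCoord (v c : ι → E) (R : ℝ) (z : E) (j : ι) : ℝ :=
  (‖v j - z‖ ^ 2 - ‖z‖ ^ 2) / power v c R j

lemma nonempty (h : CrossingConfiguration v c w R) : Nonempty ι := by
  by_contra! hι
  simpa using h.sum_weight

lemma norm_vertex_sub_center_sq (h : CrossingConfiguration v c w R) (i j : ι) [Decidable (i = j)] :
    ‖v i - c j‖ ^ 2 = R ^ 2 + if i = j then power v c R j else 0 := by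
  split_ifs with hij
  · rw [hij, power, add_sub_cancel]
  · rw [h.norm_vertex_sub_center i j hij, add_zero]

lemma sum_weight_mul_norm_sq_pos (h : CrossingConfiguration v c w R) :
    0 < ∑ i, w i * ‖v i‖ ^ 2 :=
  have := h.nonempty
  Finset.sum_pos (fun i _ => mul_pos (h.weight_pos i) (pow_pos (norm_pos_iff.2
    (h.vertex_ne_zero i)) 2)) Finset.univ_nonempty

lemma weight_mul_power (h : CrossingConfiguration v c w R) (j : ι) :
    w j * power v c R j = ∑ i, w i * ‖v i‖ ^ 2 := by
  rw [← sum_mul_norm_sub_sq_sub h.sum_weight_smul (c j), power, ← h.norm_center j]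
  rw [Fintype.sum_eq_single j]
  intro i hij
  rw [h.norm_vertex_sub_center i j hij, h.norm_center, sub_self, mul_zero]

lemma power_pos (h : CrossingConfiguration v c w R) (j : ι) : 0 < power v c R j :=
  pos_of_mul_pos_right (h.weight_mul_power j ▸ h.sum_weight_mul_norm_sq_pos) (h.weight_pos j).le

lemma centerCoord_mul_power (h : CrossingConfiguration v c w R) (z : E) (j : ι) :
    centerCoord v c R z j * power v c R j = ‖v j - z‖ ^ 2 - ‖z‖ ^ 2 :=
  div_mul_cancel₀ _ (h.power_pos j).ne'

lemma sum_centerCoord (h : CrossingConfiguration v c w R) (z : E) :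
    ∑ j, centerCoord v c R z j = 1 := by
  have hm := h.sum_weight_mul_norm_sq_pos.ne'
  have hterm : ∀ j, centerCoord v c R z j
      = w j * (‖v j - z‖ ^ 2 - ‖z‖ ^ 2) / ∑ i, w i * ‖v i‖ ^ 2 := fun j => by
    rw [← h.weight_mul_power j, mul_div_mul_left _ _ (h.weight_pos j).ne', centerCoord]
  simp only [hterm, ← Finset.sum_div, sum_mul_norm_sub_sq_sub h.sum_weight_smul, div_self hm]

lemma eq_of_inner_vertex (h : CrossingConfiguration v c w R) {y z : E}
    (hyz : ∀ i, ⟪v i, y⟫_ℝ = ⟪v i, z⟫_ℝ) : y = z := by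
  refine ext_inner_left ℝ fun x => ?_
  have hx : x ∈ Submodule.span ℝ (Set.range v) := h.span_vertices ▸ Submodule.mem_top
  exact LinearMap.eqOn_span (f := (innerₗ E).flip y) (g := (innerₗ E).flip z)
    (Set.forall_mem_range.2 hyz) hx

lemma sum_centerCoord_smul (h : CrossingConfiguration v c w R) (z : E) :
    ∑ j, centerCoord v c R z j • c j = z := by
  classical
  refine h.eq_of_inner_vertex fun i => ?_
  have hcenter : ∀ j, 2 * ⟪v i, c j⟫_ℝ = ‖v i‖ ^ 2 - if i = j then power v c R j else 0 :=
    fun j => by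
      have := norm_sub_sq_real (v i) (c j)
      rw [h.norm_vertex_sub_center_sq, h.norm_center] at this
      linarith
  have hsum : ∑ j, centerCoord v c R z j * (2 * ⟪v i, c j⟫_ℝ)
      = ‖v i‖ ^ 2 - centerCoord v c R z i * power v c R i := by
    simp only [hcenter, mul_sub, Finset.sum_sub_distrib, ← Finset.sum_mul, h.sum_centerCoord,
      one_mul, mul_ite, mul_zero, Fintype.sum_ite_eq]
  rw [h.centerCoord_mul_power, norm_sub_sq_real] at hsum
  simp only [mul_left_comm _ (2 : ℝ), ← Finset.mul_sum] at hsum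
  simp only [inner_sum, real_inner_smul_right]
  linarith

lemma centerCoord_zero_pos (h : CrossingConfiguration v c w R) (j : ι) :
    0 < centerCoord v c R 0 j := by
  have hnorm := pow_pos (norm_pos_iff.2 (h.vertex_ne_zero j)) 2
  exact div_pos (by simpa using hnorm) (h.power_pos j)

lemma power_div_le_norm_center_sub_sq (h : CrossingConfiguration v c w R) {j k : ι} (hjk : j ≠ k) :
    power v c R j / (4 * centerCoord v c R 0 j) ≤ ‖c j - c k‖ ^ 2 := by
  have hpow := h.power_pos j
  have hcoord := h.centerCoord_zero_pos j
  have hnorm : ‖v j‖ ^ 2 = centerCoord v c R 0 j * power v c R j := by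
    simp [h.centerCoord_mul_power]
  have hinner : 2 * ⟪v j, c j - c k⟫_ℝ = -power v c R j := by
    have h1 := norm_sub_sq_real (v j) (c j)
    have h2 := norm_sub_sq_real (v j) (c k)
    rw [h.norm_center] at h1 h2
    rw [h.norm_vertex_sub_center j k hjk] at h2
    rw [inner_sub_right, power]
    linarith
  have hcs : ⟪v j, c j - c k⟫_ℝ ^ 2 ≤ ‖v j‖ ^ 2 * ‖c j - c k‖ ^ 2 := by
    rw [← mul_pow]
    exact sq_le_sq' (neg_le_of_abs_le (abs_real_inner_le_norm _ _)) (real_inner_le_norm _ _)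
  have hprod : power v c R j * power v c R j
      ≤ power v c R j * (‖c j - c k‖ ^ 2 * (4 * centerCoord v c R 0 j)) := by
    rw [hnorm] at hcs
    linear_combination 4 * hcs + (power v c R j - 2 * ⟪v j, c j - c k⟫_ℝ) * hinner
  rw [div_le_iff₀ (by positivity)]
  exact le_of_mul_le_mul_left hprod hpow

lemma sq_sub_norm_sq_le (h : CrossingConfiguration v c w R) {ρ : ℝ} {z : E} (hρ : 0 ≤ ρ)
    (hv : ∀ i, ρ ≤ ‖v i - z‖) (j : ι) :
    ρ ^ 2 - ‖z‖ ^ 2 ≤ centerCoord v c R z j * power v c R j := by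
  rw [h.centerCoord_mul_power]
  gcongr
  exact hv j

lemma centerCoord_mem_stdSimplex (h : CrossingConfiguration v c w R) {ρ : ℝ} {z : E}
    (hz : ‖z‖ ≤ ρ) (hv : ∀ i, ρ ≤ ‖v i - z‖) : centerCoord v c R z ∈ stdSimplex ℝ ι := by
  refine ⟨fun j => ?_, h.sum_centerCoord z⟩
  exact div_nonneg (sub_nonneg.2 (pow_le_pow_left₀ (norm_nonneg z) (hz.trans (hv j)) 2))
    (h.power_pos j).le

lemma mul_one_sub_div_le_sum (h : CrossingConfiguration v c w R) {ρ : ℝ} {z : E}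
    (hz : ‖z‖ ≤ ρ) (hv : ∀ i, ρ ≤ ‖v i - z‖) (j : ι) :
    (ρ ^ 2 - ‖z‖ ^ 2) / 4 * ((1 - centerCoord v c R z j) / centerCoord v c R 0 j)
      ≤ ∑ k, centerCoord v c R z j * centerCoord v c R z k * ‖c j - c k‖ ^ 2 := by
  classical
  have hν := h.centerCoord_mem_stdSimplex hz hv
  have hP := h.sq_sub_norm_sq_le ((norm_nonneg z).trans hz) hv j
  have hb := h.centerCoord_zero_pos j
  set ν := centerCoord v c R z
  set b := centerCoord v c R 0
  have hrest : 1 - ν j = ∑ k ∈ Finset.univ.erase j, ν k := by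
    rw [← hν.2, ← Finset.add_sum_erase _ _ (Finset.mem_univ j), add_sub_cancel_left]
  have hrest0 : 0 ≤ 1 - ν j := hrest ▸ Finset.sum_nonneg fun k _ => hν.1 k
  calc (ρ ^ 2 - ‖z‖ ^ 2) / 4 * ((1 - ν j) / b j)
      ≤ ν j * power v c R j / 4 * ((1 - ν j) / b j) := by gcongr
    _ = ∑ k ∈ Finset.univ.erase j, ν j * ν k * (power v c R j / (4 * b j)) := by
        rw [← Finset.sum_mul, ← Finset.mul_sum, ← hrest]
        field_simp
    _ ≤ ∑ k ∈ Finset.univ.erase j, ν j * ν k * ‖c j - c k‖ ^ 2 := by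
        refine Finset.sum_le_sum fun k hk => mul_le_mul_of_nonneg_left ?_
          (mul_nonneg (hν.1 j) (hν.1 k))
        exact h.power_div_le_norm_center_sub_sq (Finset.ne_of_mem_erase hk).symm
    _ ≤ ∑ k, ν j * ν k * ‖c j - c k‖ ^ 2 :=
        Finset.sum_le_sum_of_subset_of_nonneg (Finset.erase_subset _ _) fun k _ _ =>
          mul_nonneg (mul_nonneg (hν.1 j) (hν.1 k)) (sq_nonneg _)

lemma sq_card_sub_one_mul_le (h : CrossingConfiguration v c w R) {ρ : ℝ} {z : E}
    (hz : ‖z‖ ≤ ρ) (hv : ∀ i, ρ ≤ ‖v i - z‖) :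
    ((Fintype.card ι : ℝ) - 1) ^ 2 * (ρ ^ 2 - ‖z‖ ^ 2) ≤ 8 * (R ^ 2 - ‖z‖ ^ 2) := by
  have hν := h.centerCoord_mem_stdSimplex hz hv
  have hP : 0 ≤ ρ ^ 2 - ‖z‖ ^ 2 := sub_nonneg.2 (pow_le_pow_left₀ (norm_nonneg z) hz 2)
  have hnorm := two_mul_norm_sum_smul_sq h.norm_center hν.2
  rw [h.sum_centerCoord_smul] at hnorm
  have hrows := Finset.sum_le_sum fun j (_ : j ∈ Finset.univ) => h.mul_one_sub_div_le_sum hz hv j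
  rw [← Finset.mul_sum] at hrows
  have hcard := mul_le_mul_of_nonneg_left
    (sq_card_sub_one_le_sum_div h.centerCoord_zero_pos (h.sum_centerCoord 0) hν) hP
  linarith

theorem eq_of_forall_le_norm_vertex_sub (h : CrossingConfiguration v c w R)
    (hι : 4 ≤ Fintype.card ι) {ρ : ℝ} {z : E} (hR : R ≤ ρ) (hz : ‖z‖ ≤ ρ)
    (hv : ∀ i, ρ ≤ ‖v i - z‖) : ρ = R ∧ ‖z‖ = ρ := by
  obtain ⟨j⟩ := h.nonempty
  have hR0 : 0 ≤ R := h.norm_center j ▸ norm_nonneg _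
  have hρ0 : 0 ≤ ρ := hR0.trans hR
  have hP : 0 ≤ ρ ^ 2 - ‖z‖ ^ 2 := sub_nonneg.2 (pow_le_pow_left₀ (norm_nonneg z) hz 2)
  have hRρ : R ^ 2 ≤ ρ ^ 2 := pow_le_pow_left₀ hR0 hR 2
  have hcard : (9 : ℝ) ≤ ((Fintype.card ι : ℝ) - 1) ^ 2 := by
    have : (4 : ℝ) ≤ Fintype.card ι := by exact_mod_cast hι
    nlinarith
  have hkey := h.sq_card_sub_one_mul_le hz hv
  have hnine := mul_le_mul_of_nonneg_right hcard hP
  exact ⟨(pow_left_inj₀ hρ0 hR0 two_ne_zero).1 (by linarith),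
    (pow_left_inj₀ (norm_nonneg z) hρ0 two_ne_zero).1 (by linarith)⟩

lemma radius_le_norm_vertex_sub_center (h : CrossingConfiguration v c w R) (i j : ι) :
    R ≤ ‖v i - c j‖ := by
  classical
  refine le_of_sq_le_sq ?_ (norm_nonneg _)
  have := h.power_pos j
  rw [h.norm_vertex_sub_center_sq]
  split_ifs <;> linarith

/-- The origin lies inside the circumscribed sphere, which has no vertex in its interior and hence
cannot be as large as the crossing spheres. -/
lemma circumradius_lt (h : CrossingConfiguration v c w R) (hι : 4 ≤ Fintype.card ι) {r : ℝ} {q : E}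
    (hr : 0 ≤ r) (hq : ∀ i, ‖v i - q‖ = r) : r < R := by
  have hlt : ‖q‖ < r := by
    have hmoment := sum_mul_norm_sub_sq_sub h.sum_weight_smul q
    simp only [hq, ← Finset.sum_mul, h.sum_weight, one_mul] at hmoment
    refine lt_of_pow_lt_pow_left₀ 2 hr (sub_pos.1 ?_)
    rw [hmoment]
    exact h.sum_weight_mul_norm_sq_pos
  by_contra! hle
  exact hlt.ne (h.eq_of_forall_le_norm_vertex_sub hι hle hlt.le fun i => (hq i).ge).2

end CrossingConfiguration

end CrossingConfiguration

section Simplex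

variable {E : Type*} [NormedAddCommGroup E] [InnerProductSpace ℝ E] {n : ℕ}

/-- `O` is a common point of `n + 1` spheres of radius `R`, the `j`-th of which passes through all
vertices of `s` but possibly the `j`-th one. -/
def IsFacetCrossing (s : Affine.Simplex ℝ E n) (R : ℝ) (O : E) : Prop :=
  ∃ c : Fin (n + 1) → E, (∀ j, dist O (c j) = R) ∧
    ∀ i j, i ≠ j → dist (s.points i) (c j) = R

/-- The infimum of the radii, larger than the circumradius, for which the ball hull of the vertices
has nonempty interior. For tetrahedra it unfolds to `Tetrahedron.rL`. -/
noncomputable def criticalRadius (s : Affine.Simplex ℝ E n) : ℝ :=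
  sInf {ρ : ℝ | s.circumradius < ρ ∧ (interior (ballHull ρ (Set.range s.points))).Nonempty}

lemma exists_affineBasis_of_mem_interior {s : Affine.Simplex ℝ E n} {O : E}
    (hO : O ∈ interior (convexHull ℝ (Set.range s.points))) :
    ∃ b : AffineBasis (Fin (n + 1)) ℝ E, ⇑b = s.points ∧ ∀ i, 0 < b.coord i O := by
  let b : AffineBasis (Fin (n + 1)) ℝ E :=
    ⟨s.points, s.independent, affineSpan_eq_top_of_nonempty_interior ⟨O, hO⟩⟩
  have hb : O ∈ interior (convexHull ℝ (Set.range b)) := hO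
  rw [b.interior_convexHull] at hb
  exact ⟨b, rfl, hb⟩

lemma notMem_range_points_of_mem_interior [NeZero n] {s : Affine.Simplex ℝ E n} {O : E}
    (hO : O ∈ interior (convexHull ℝ (Set.range s.points))) : O ∉ Set.range s.points := by
  obtain ⟨b, hb, hpos⟩ := exists_affineBasis_of_mem_interior hO
  rintro ⟨i, rfl⟩
  obtain ⟨j, hj⟩ := exists_ne i
  have := hpos j
  rw [← hb, b.coord_apply_ne hj] at this
  exact this.false

lemma exists_crossingConfiguration [NeZero n] {s : Affine.Simplex ℝ E n} {R : ℝ} {O : E}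
    {c : Fin (n + 1) → E} (hO : O ∈ interior (convexHull ℝ (Set.range s.points)))
    (hc : ∀ j, dist O (c j) = R) (hs : ∀ i j, i ≠ j → dist (s.points i) (c j) = R) :
    ∃ w, CrossingConfiguration (fun i => s.points i - O) (fun j => c j - O) w R := by
  obtain ⟨b, hb, hpos⟩ := exists_affineBasis_of_mem_interior hO
  have hcomb : ∀ y, ∑ i, b.coord i y • (s.points i - O) = y - O := fun y => by
    simp only [← hb, smul_sub, Finset.sum_sub_distrib, b.linear_combination_coord_eq_self,
      ← Finset.sum_smul, b.sum_coord_apply_eq_one, one_smul]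
  refine ⟨fun i => b.coord i O, hpos, b.sum_coord_apply_eq_one O, by rw [hcomb, sub_self],
    fun i hi => ?_, ?_, fun j => ?_, fun i j hij => ?_⟩
  · exact notMem_range_points_of_mem_interior hO ⟨i, sub_eq_zero.1 hi⟩
  · refine eq_top_iff.2 fun y _ => ?_
    rw [← add_sub_cancel_right y O, ← hcomb]
    exact Submodule.sum_mem _ fun i _ => Submodule.smul_mem _ _ (Submodule.subset_span ⟨i, rfl⟩)
  · rw [← dist_eq_norm, dist_comm, hc]
  · rw [sub_sub_sub_cancel_right, ← dist_eq_norm, hs i j hij]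

namespace IsFacetCrossing

variable {s : Affine.Simplex ℝ E n} {R : ℝ} {O : E}

lemma eq_of_forall_le_dist (h : IsFacetCrossing s R O)
    (hO : O ∈ interior (convexHull ℝ (Set.range s.points))) (hn : 3 ≤ n) {ρ : ℝ} {z : E}
    (hR : R ≤ ρ) (hz : dist O z ≤ ρ) (hv : ∀ i, ρ ≤ dist (s.points i) z) :
    ρ = R ∧ dist O z = ρ := by
  have : NeZero n := ⟨by omega⟩
  obtain ⟨c, hc, hs⟩ := h
  obtain ⟨w, hw⟩ := exists_crossingConfiguration hO hc hs
  rw [dist_comm, dist_eq_norm] at hz ⊢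
  refine hw.eq_of_forall_le_norm_vertex_sub (by simpa using hn) hR hz fun i => ?_
  rw [sub_sub_sub_cancel_right, ← dist_eq_norm]
  exact hv i

lemma circumradius_lt (h : IsFacetCrossing s R O)
    (hO : O ∈ interior (convexHull ℝ (Set.range s.points))) (hn : 3 ≤ n) :
    s.circumradius < R := by
  have : NeZero n := ⟨by omega⟩
  obtain ⟨c, hc, hs⟩ := h
  obtain ⟨w, hw⟩ := exists_crossingConfiguration hO hc hs
  refine hw.circumradius_lt (by simpa using hn) (q := s.circumcenter - O)
    s.circumradius_nonneg fun i => ?_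
  rw [sub_sub_sub_cancel_right, ← dist_eq_norm, s.dist_circumcenter_eq_circumradius]

lemma ballHull_subset [NeZero n] (h : IsFacetCrossing s R O)
    (hO : O ∈ interior (convexHull ℝ (Set.range s.points))) (hR : 0 < R) :
    ballHull R (Set.range s.points) ⊆ Set.range s.points ∪ {O} := by
  intro x hx
  obtain ⟨c, hc, hs⟩ := h
  obtain ⟨w, hw⟩ := exists_crossingConfiguration hO hc hs
  have hx_hull : x ∈ convexHull ℝ (Set.range s.points) :=
    ballHull_subset_of_convex hR (subset_convexHull ℝ _) (convex_convexHull ℝ _)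
      ((Set.finite_range s.points).isCompact_convexHull ℝ).isComplete ⟨O, interior_subset hO⟩ hx
  obtain ⟨j, hj⟩ := exists_mem_convexHull_range_update (interior_subset hO) hx_hull
  have hsphere : ∀ a ∈ Set.range (Function.update s.points j O), dist a (c j) ≤ R := by
    rintro _ ⟨i, rfl⟩
    rcases eq_or_ne i j with rfl | hij
    · simp [hc]
    · simp [hij, hs i j hij]
  have hmiss : ∀ a ∈ Set.range s.points, R ≤ dist a (c j) := by
    rintro _ ⟨i, rfl⟩
    have := hw.radius_le_norm_vertex_sub_center i j
    rwa [sub_sub_sub_cancel_right, ← dist_eq_norm] at this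
  have hrange : Set.range (Function.update s.points j O) ⊆ Set.range s.points ∪ {O} := by
    rintro _ ⟨i, rfl⟩
    rcases eq_or_ne i j with rfl | hij
    · simp
    · simp [hij]
  by_contra hx_notMem
  exact (mem_ballHull_iff.1 hx (c j) hmiss).not_gt
    (dist_lt_of_mem_convexHull hR.ne' hsphere hj fun hx_range => hx_notMem (hrange hx_range))

lemma ballHull_eq (h : IsFacetCrossing s R O)
    (hO : O ∈ interior (convexHull ℝ (Set.range s.points))) (hn : 3 ≤ n) :
    ballHull R (Set.range s.points) = Set.range s.points ∪ {O} := by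
  have : NeZero n := ⟨by omega⟩
  have hR : 0 < R := s.circumradius_nonneg.trans_lt (h.circumradius_lt hO hn)
  refine (h.ballHull_subset hO hR).antisymm (Set.union_subset (subset_ballHull _ _) ?_)
  refine Set.singleton_subset_iff.2 (mem_ballHull_iff.2 fun z hz => ?_)
  by_contra! hlt
  exact hlt.ne (h.eq_of_forall_le_dist hO hn le_rfl hlt.le fun i => hz _ ⟨i, rfl⟩).2

lemma mem_interior_ballHull (h : IsFacetCrossing s R O)
    (hO : O ∈ interior (convexHull ℝ (Set.range s.points))) (hn : 3 ≤ n) {ρ : ℝ} (hρ : R < ρ) :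
    O ∈ interior (ballHull ρ (Set.range s.points)) := by
  obtain ⟨b, -⟩ := exists_affineBasis_of_mem_interior hO
  have := b.finiteDimensional
  have := FiniteDimensional.proper_real E
  refine _root_.mem_interior_ballHull fun z hz => ?_
  by_contra! hle
  exact hρ.ne' (h.eq_of_forall_le_dist hO hn hρ.le hle fun i => hz _ ⟨i, rfl⟩).1

lemma criticalRadius_eq (h : IsFacetCrossing s R O)
    (hO : O ∈ interior (convexHull ℝ (Set.range s.points))) (hn : 3 ≤ n) :
    criticalRadius s = R := by
  have : NeZero n := ⟨by omega⟩
  have hmem : ∀ ρ, R < ρ → ρ ∈ {ρ : ℝ | s.circumradius < ρ ∧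
      (interior (ballHull ρ (Set.range s.points))).Nonempty} := fun ρ hρ =>
    ⟨(h.circumradius_lt hO hn).trans hρ, O, h.mem_interior_ballHull hO hn hρ⟩
  have : Nontrivial E := s.independent.injective.nontrivial
  refine csInf_eq_of_forall_ge_of_forall_gt_exists_lt ⟨R + 1, hmem _ (lt_add_one R)⟩ ?_ ?_
  · rintro ρ ⟨hρ, x, hx⟩
    by_contra! hlt
    have hsub := ballHull_mono_radius (s.circumradius_nonneg.trans_lt hρ) hlt.le
      (Set.range s.points)
    rw [h.ballHull_eq hO hn] at hsub
    have hfinite := ((Set.finite_range s.points).union (Set.finite_singleton O)).subset hsub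
    have := Module.punctured_nhds_neBot ℝ E x
    exact infinite_of_mem_nhds x (mem_interior_iff_mem_nhds.1 hx) hfinite
  · intro u hu
    obtain ⟨ρ, hRρ, hρu⟩ := exists_between hu
    exact ⟨ρ, hmem ρ hRρ, hρu⟩

end IsFacetCrossing

end Simplex

lemma eq_of_union_singleton_eq {α : Type*} {A : Set α} {p q : α} (hp : p ∉ A)
    (h : A ∪ {q} = A ∪ {p}) : p = q := by
  rw [Set.union_singleton, Set.union_singleton] at h
  exact ((Set.insert_inj hp).1 h.symm)

lemma Tetrahedron.IsFourCrossing.isFacetCrossing {T : Tetrahedron} {R : ℝ} {O : E3}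
    (h : T.IsFourCrossing R O) : IsFacetCrossing T R O := by
  obtain ⟨-, S, -, hradius, hmem, hinter, -⟩ := h
  have hO : O ∈ ⋂ j, {x : E3 | x ∈ S j} := hinter ▸ Set.mem_singleton O
  exact ⟨fun j => (S j).center, fun j => hradius j ▸ Set.mem_iInter.1 hO j,
    fun i j hij => hradius j ▸ hmem j i hij⟩

theorem theorem4p3_general {E : Type*} [NormedAddCommGroup E] [InnerProductSpace ℝ E] {n : ℕ}
    (hn : 3 ≤ n) (s : Affine.Simplex ℝ E n) (R : ℝ) (O : E) (hRO : IsFacetCrossing s R O)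
    (hO : O ∈ interior (convexHull ℝ (Set.range s.points))) :
    (∀ (R' : ℝ) (O' : E), IsFacetCrossing s R' O' →
      O' ∈ interior (convexHull ℝ (Set.range s.points)) → R' = R ∧ O' = O) ∧
    s.circumradius < criticalRadius s ∧ R = criticalRadius s ∧
    ballHull (criticalRadius s) (Set.range s.points) = Set.range s.points ∪ {O} ∧
    (∀ p : E, p ∉ Set.range s.points →
      ballHull (criticalRadius s) (Set.range s.points) = Set.range s.points ∪ {p} → p = O) := by
  have : NeZero n := ⟨by omega⟩
  have hradius := hRO.criticalRadius_eq hO hn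
  have hhull := hRO.ballHull_eq hO hn
  rw [hradius]
  refine ⟨fun R' O' hRO' hO' => ?_, hRO.circumradius_lt hO hn, rfl, hhull,
    fun p hp hp_hull => eq_of_union_singleton_eq hp (hhull.symm.trans hp_hull)⟩
  obtain rfl : R' = R := (hRO'.criticalRadius_eq hO' hn).symm.trans hradius
  exact ⟨rfl, eq_of_union_singleton_eq (notMem_range_points_of_mem_interior hO')
    (hhull.symm.trans (hRO'.ballHull_eq hO' hn))⟩

theorem theorem4p3 (T : Tetrahedron) (R : ℝ) (O : E3)
    (hRO : T.IsFourCrossing R O) (hO : O ∈ interior T.solid) :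
    -- `R` and `O` are uniquely determined
    (∀ (R' : ℝ) (O' : E3), T.IsFourCrossing R' O' → O' ∈ interior T.solid →
      R' = R ∧ O' = O) ∧
    -- `R = r_L(V) > r(V)`
    T.circumradius < T.rL ∧ R = T.rL ∧
    -- `O` is the point `O*` with `co_{r_L(V)}(V) = V ∪ {O*}`, the only one outside `V`
    hulloid T.rL T.vertices = T.vertices ∪ {O} ∧
    (∀ p : E3, p ∉ T.vertices → hulloid T.rL T.vertices = T.vertices ∪ {p} → p = O) := by
  obtain ⟨hunique, hrest⟩ := theorem4p3_general le_rfl T R O hRO.isFacetCrossing hO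
  exact ⟨fun R' O' h => hunique R' O' h.isFacetCrossing, hrest⟩
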